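/- All graphs are finite, simple and nonempty. A \emph{cover} of a graph $G$ is a pair $\mathcal H=(L,H)$ of a graph $H$ and a function $L:V(G)\to\mathcal P(V(H))$ such that the sets $L(u)$, $u\in V(G)$, are nonempty, pairwise disjoint and have union $V(H)$; each $H[L(u)]$ is complete; an edge of $H$ between $L(u)$ and $L(v)$ with $u\neq v$ exists only if $uv\in E(G)$; and for every $uv\in E(G)$ the edges of $H$ between $L(u)$ and $L(v)$ form a (possibly empty) matching. The cover is \emph{$m$-fold} if $|L(u)|=m$ for all $u$. An \emph{$\mathcal H$-coloring} is an independent set of $H$ of size $|V(G)|$. Let $P_{DP}(G,m)$ be the minimum number of $\mathcal H$-colorings over all $m$-fold covers $\mathcal H$ of $G$, and let $P(G,m)$ be the number of proper $m$-colorings of $G$. The \emph{DP color function threshold} $\tau_{DP}(G)$ is the smallest integer $N\ge\chi(G)$ such that $P_{DP}(G,m)=P(G,m)$ for all $m\ge N$ (and $\infty$ if there is no such $N$). Write $G\vee G'$ for the join of $G$ and $G'$, $K_p$ for the complete graph on $p$ vertices and $C_n$ for the cycle on $n$ vertices. \textbf{Theorem.} For all integers $p\ge 1$ and $n\ge 3$,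 $$\tau_{DP}(K_p\vee C_n)=p+3.$$ Moreover, suppose that $n$ is even, and let $v_1,\dots,v_n$ be the vertices of $C_n$ in cyclic order. Let $\mathcal H=(L,H)$ be the following cover of $M=K_p\vee C_n$: $L(u)=\{u\}\times\{1,\dots,p+2\}$ for each $u\in V(M)$; each $L(u)$ induces a complete graph in $H$; for each edge $uv\neq v_1v_n$ of $M$, the edges of $H$ between $L(u)$ and $L(v)$ are $(u,j)(v,j)$ for $1\le j\le p+2$; and the edges of $H$ between $L(v_1)$ and $L(v_n)$ are $(v_1,j)(v_n,j+1)$ for $1\le j\le p+1$ together with $(v_1,p+2)(v_n,1)$. Then $\mathcal H$ is a $(p+2)$-fold cover of $M$ with fewer than $(p+2)!$ $\mathcal H$-colorings. -/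

import Mathlib

open scoped Nat

namespace DPColoring

/-- The join `G ∨ H`: the disjoint union of `G` and `H` together with all edges between them. -/
def join {V W : Type*} (G : SimpleGraph V) (H : SimpleGraph W) : SimpleGraph (V ⊕ W) :=
  (G ⊕g H) ⊔ completeBipartiteGraph V W

/-- A cover `(L, H)` of the graph `G`, where `H` is a graph with vertex set `W`. -/
structure Cover {V : Type*} (G : SimpleGraph V) (W : Type*) where
  /-- the graph of the cover -/
  H : SimpleGraph W
  /-- the part of `H` that lies over a vertex of `G` -/
  L : V → Set W
  /-- the parts are nonempty -/
  nonempty : ∀ u, (L u).Nonempty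
  /-- the parts are pairwise disjoint and their union is the whole vertex set of `H` -/
  partition : ∀ x, ∃! u, x ∈ L u
  /-- each part induces a complete graph -/
  complete : ∀ u, H.IsClique (L u)
  /-- edges of `H` run inside a part or between the parts of two adjacent vertices of `G` -/
  cross : ∀ u v x y, x ∈ L u → y ∈ L v → H.Adj x y → u = v ∨ G.Adj u v
  /-- the edges between the parts of two adjacent vertices form a (possibly empty) matching:
  a vertex of either part has at most one neighbour in the other one -/
  matching : ∀ u v, G.Adj u v → ∀ x ∈ L u, ∀ y ∈ L v, ∀ z ∈ L v, H.Adj x y → H.Adj x z → y = z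

/-- The cover is `m`-fold: every part has exactly `m` elements. -/
def Cover.IsFold {V W : Type*} {G : SimpleGraph V} (C : Cover G W) (m : ℕ) : Prop :=
  ∀ u, (C.L u).encard = m

/-- The colorings of a cover: the independent sets of `H` of size `|V(G)|`. -/
def Cover.colorings {V W : Type*} [Fintype V] {G : SimpleGraph V} (C : Cover G W) :
    Set (Finset W) :=
  {I | C.H.IsIndepSet (I : Set W) ∧ I.card = Fintype.card V}

/-- `P_DP(G, (L, H))`: the number of colorings of the cover. -/
noncomputable def Cover.numColorings {V W : Type*} [Fintype V] {G : SimpleGraph V}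
    (C : Cover G W) : ℕ :=
  C.colorings.ncard

/-- The DP color function `P_DP(G, m)`: the minimum number of colorings over all `m`-fold covers
of `G`. The graph of an `m`-fold cover of a finite graph is finite, so it is no loss to take its
vertex set in `Type`. -/
noncomputable def dpColorFunction {V : Type*} [Fintype V] (G : SimpleGraph V) (m : ℕ) : ℕ :=
  sInf {k | ∃ (W : Type) (C : Cover G W), C.IsFold m ∧ C.numColorings = k}

/-- The chromatic polynomial `P(G, m)`: the number of proper `m`-colorings of `G`. -/
noncomputable def numProperColorings {V : Type*} (G : SimpleGraph V) (m : ℕ) : ℕ :=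
  Nat.card (G.Coloring (Fin m))

/-- The DP color function threshold: the smallest `N ≥ χ(G)` with `P_DP(G, m) = P(G, m)` for all
`m ≥ N`, and `⊤` if there is no such `N`. -/
noncomputable def dpThreshold {V : Type*} [Fintype V] (G : SimpleGraph V) : ℕ∞ :=
  sInf {t | ∃ N : ℕ, t = N ∧ G.chromaticNumber ≤ N ∧
    ∀ m, N ≤ m → dpColorFunction G m = numProperColorings G m}

/-- The graph `K_p ∨ C_n`. -/
def completeJoinCycle (p n : ℕ) : SimpleGraph (Fin p ⊕ Fin n) :=
  join (⊤ : SimpleGraph (Fin p)) (SimpleGraph.cycleGraph n)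

/-- `u` is the first and `v` the last vertex of the cycle `C_n` in `K_p ∨ C_n`. -/
def IsFirstLast {p n : ℕ} (u v : Fin p ⊕ Fin n) : Prop :=
  ∃ a b : Fin n, u = Sum.inr a ∧ v = Sum.inr b ∧ (a : ℕ) = 0 ∧ (b : ℕ) = n - 1

/-- Which colors are matched along an edge `uv` of `K_p ∨ C_n` in the twisted cover: the color
`i` of `u` is matched with the color `i` of `v`, except on the edge between the first vertex and
the last vertex of the cycle, where the color `i` of the first vertex is matched with the color
`i + 1` (cyclically) of the last one. -/
def twistMatched {p n : ℕ} (u v : Fin p ⊕ Fin n) (i j : Fin (p + 2)) : Prop :=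
  (IsFirstLast u v ∧ j = i + 1) ∨ (IsFirstLast v u ∧ i = j + 1) ∨
    (¬ IsFirstLast u v ∧ ¬ IsFirstLast v u ∧ i = j)

theorem twistMatched_symm {p n : ℕ} {u v : Fin p ⊕ Fin n} {i j : Fin (p + 2)}
    (h : twistMatched u v i j) : twistMatched v u j i := by
  unfold twistMatched at *
  tauto

theorem not_isFirstLast_both {p n : ℕ} {u v : Fin p ⊕ Fin n} (huv : u ≠ v)
    (h : IsFirstLast u v) (h' : IsFirstLast v u) : False := by
  obtain ⟨a, b, rfl, rfl, ha, hb⟩ := h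
  obtain ⟨c, d, hc, hd, hc0, hd0⟩ := h'
  simp only [Sum.inr.injEq] at hc hd
  subst hc hd
  exact huv (congrArg Sum.inr (Fin.ext (by omega)))

theorem twistMatched_unique {p n : ℕ} {u v : Fin p ⊕ Fin n} {i j k : Fin (p + 2)} (huv : u ≠ v)
    (h : twistMatched u v i j) (h' : twistMatched u v i k) : j = k := by
  have hb := not_isFirstLast_both huv
  rcases h with ⟨h1, h2⟩ | ⟨h1, h2⟩ | ⟨h1, h2, h3⟩ <;>
    rcases h' with ⟨g1, g2⟩ | ⟨g1, g2⟩ | ⟨g1, g2, g3⟩ <;> try tauto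
  · exact h2.trans g2.symm
  · exact add_right_cancel (h2.symm.trans g2)
  · exact h3.symm.trans g3

/-- The twisted `(p + 2)`-fold cover of `K_p ∨ C_n`, with parts `L(u) = {u} × {0, …, p + 1}`. -/
def twistedCover (p n : ℕ) :
    Cover (completeJoinCycle p n) ((Fin p ⊕ Fin n) × Fin (p + 2)) where
  H :=
    { Adj := fun x y => (x.1 = y.1 ∧ x.2 ≠ y.2) ∨
        ((completeJoinCycle p n).Adj x.1 y.1 ∧ twistMatched x.1 y.1 x.2 y.2)
      symm := ⟨fun x y h => by
        rcases h with ⟨h1, h2⟩ | ⟨h1, h2⟩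
        · exact Or.inl ⟨h1.symm, h2.symm⟩
        · exact Or.inr ⟨h1.symm, twistMatched_symm h2⟩⟩
      loopless := ⟨fun x h => by
        rcases h with ⟨_, h2⟩ | ⟨h1, _⟩
        · exact h2 rfl
        · exact h1.ne rfl⟩ }
  L := fun u => {x | x.1 = u}
  nonempty := fun u => ⟨(u, 0), rfl⟩
  partition := fun x => ⟨x.1, rfl, fun _ h => h.symm⟩
  complete := by
    rintro u ⟨x, i⟩ rfl ⟨y, j⟩ hy hne
    have hy' : y = x := hy
    subst hy'
    exact Or.inl ⟨rfl, fun h => hne (Prod.ext rfl h)⟩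
  cross := by
    rintro u v x y rfl rfl h
    exact h.imp And.left And.left
  matching := by
    rintro u v huv x rfl y rfl z hz h h'
    have hz' : z.1 = y.1 := hz
    have hne := huv.ne
    rcases h with ⟨h1, _⟩ | ⟨_, h2⟩
    · exact absurd h1 hne
    rcases h' with ⟨g1, _⟩ | ⟨_, g2⟩
    · exact absurd (g1.trans hz') hne
    rw [hz'] at g2
    exact Prod.ext hz'.symm (twistMatched_unique hne h2 g2)

end DPColoring

/-! For the upper bound take `m ≥ p + 3`, `q = m - p - 1 ≥ 2` and `n = t + 1`. Coloring a vertex of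
`K_p` deletes at most one color from every other list, so once all but one vertex of `K_p` are
colored, a wheel with lists of size at least `q + 2` remains. It is enough that a wheel with
matchings has at least as many colorings as in the untwisted case (`le_card_wheelColorings`); the
product of the successive list sizes then gives `P(G, m)`.

For a wheel, extending the matchings to bijections only loses colorings, and renaming the rim colors
along the spokes leaves one permutation `σ j` per rim edge. With `w = walkCount q t`, the rim
colorings for a hub color `c` number at least `w * X + (-1) ^ t * D`: `X` counts the admissible
pairs of end colors of the rim path, `D` the colors not returned to themselves around the rim. If
`t` is even, each `c` already gives the untwisted count. If `t` is odd, let `U` be the set of colors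
moved by some `σ j`. Each `c` loses at most `|U|`, and each `c ∈ U` recovers `w + 1`, because it
frees one more closing pair and is not itself counted in `D`. Since `w ≥ q + 1`, the gains pay for
the losses.

With `p + 2` colors the equality fails or is irrelevant: for odd `n` there is no proper coloring,
and for even `n` the twisted cover has fewer than `(p + 2)! = P(G, p + 2)` colorings. -/

namespace DPColoring

/-! ### Walks and closed walks twisted by permutations -/

/-- The number of proper walks of length `t` between two given distinct vertices of the complete
graph on `q + 1` vertices. -/
def walkCount (q : ℕ) : ℕ → ℤ
  | 0 => 0
  | t + 1 => (q : ℤ) ^ t - walkCount q t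

theorem succ_mul_walkCount (q t : ℕ) :
    ((q : ℤ) + 1) * walkCount q t = (q : ℤ) ^ t - (-1) ^ t := by
  induction t with
  | zero => simp [walkCount]
  | succ t ih => rw [walkCount, mul_sub, ih]; ring

theorem walkCount_nonneg {q : ℕ} (hq : 1 ≤ q) (t : ℕ) : 0 ≤ walkCount q t := by
  have h := succ_mul_walkCount q t
  have h1 : (1 : ℤ) ≤ (q : ℤ) ^ t := one_le_pow₀ (by exact_mod_cast hq)
  have h2 : (-1 : ℤ) ^ t ≤ 1 := by
    rcases neg_one_pow_eq_or ℤ t with h | h <;> simp [h]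
  have h3 : (0 : ℤ) ≤ ((q : ℤ) + 1) * walkCount q t := by linarith
  exact nonneg_of_mul_nonneg_right h3 (by positivity)

theorem walkCount_pos {q : ℕ} (hq : 2 ≤ q) {t : ℕ} (ht : 1 ≤ t) : 0 < walkCount q t := by
  have h := succ_mul_walkCount q t
  have h1 : (1 : ℤ) < (q : ℤ) ^ t := one_lt_pow₀ (by exact_mod_cast hq) (by omega)
  have h2 : (-1 : ℤ) ^ t ≤ 1 := by
    rcases neg_one_pow_eq_or ℤ t with h | h <;> simp [h]
  have h3 : (0 : ℤ) < ((q : ℤ) + 1) * walkCount q t := by linarith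
  exact pos_of_mul_pos_right h3 (by positivity)

/-- This reduces to `(q + 1) ^ 2 ≤ q ^ 3 + 1`, which fails at `q = 1`; for even cycles the threshold
`p + 3` comes from here. -/
theorem le_walkCount {q t : ℕ} (hq : 2 ≤ q) (ht : 3 ≤ t) (hodd : Odd t) :
    (q : ℤ) + 1 ≤ walkCount q t := by
  have h := succ_mul_walkCount q t
  rw [hodd.neg_one_pow] at h
  have hq' : (2 : ℤ) ≤ q := by exact_mod_cast hq
  have h1 : (q : ℤ) ^ 3 ≤ (q : ℤ) ^ t := pow_le_pow_right₀ (by linarith) ht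
  have h2 : ((q : ℤ) + 1) * ((q : ℤ) + 1) ≤ ((q : ℤ) + 1) * walkCount q t := by
    rw [h]; nlinarith [mul_nonneg (sub_nonneg.2 hq') (sq_nonneg ((q : ℤ) + 1))]
  exact le_of_mul_le_mul_left h2 (by positivity)

/-- The composition of the first `t` of a sequence of permutations. -/
def permComp {B : Type*} (τ : ℕ → Equiv.Perm B) : ℕ → Equiv.Perm B
  | 0 => 1
  | t + 1 => τ t * permComp τ t

theorem permComp_fixed {B : Type*} (τ : ℕ → Equiv.Perm B) (t : ℕ) {a : B}
    (h : ∀ i, i < t → τ i a = a) : permComp τ t a = a := by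
  induction t with
  | zero => rfl
  | succ t ih =>
    rw [permComp, Equiv.Perm.mul_apply, ih fun i hi => h i (by omega), h t (by omega)]

/-- Consecutive entries of `h` are not matched by the permutations `τ`. -/
def IsTwistedWalk {B : Type*} (τ : ℕ → Equiv.Perm B) (t : ℕ) (h : Fin (t + 1) → B) : Prop :=
  ∀ i : Fin t, h i.succ ≠ τ i (h i.castSucc)

theorem isTwistedWalk_snoc {B : Type*} (τ : ℕ → Equiv.Perm B) (t : ℕ) (h : Fin (t + 1) → B)
    (b : B) : IsTwistedWalk τ (t + 1) (Fin.snoc h b) ↔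
      IsTwistedWalk τ t h ∧ b ≠ τ t (h (Fin.last t)) := by
  unfold IsTwistedWalk
  rw [Fin.forall_fin_succ']
  refine and_congr (forall_congr' fun i => ?_) ?_
  · rw [Fin.succ_castSucc, Fin.snoc_castSucc, Fin.snoc_castSucc, Fin.val_castSucc]
  · rw [Fin.succ_last, Fin.snoc_last, Fin.snoc_castSucc, Fin.val_last]

-- A walk reaches `b` from any color except `(τ t).symm b`, so its count is `q ^ t` minus the count
-- at that color. The excess over `walkCount` thus travels along the permutations and changes sign
-- at each step.
open Classical in
theorem card_twistedWalk {B : Type*} [Fintype B] {q : ℕ} (hB : Fintype.card B = q + 1)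
    (τ : ℕ → Equiv.Perm B) (t : ℕ) (a b : B) :
    ((Finset.univ.filter fun h : Fin (t + 1) → B =>
      IsTwistedWalk τ t h ∧ h 0 = a ∧ h (Fin.last t) = b).card : ℤ) =
      walkCount q t + if b = permComp τ t a then (-1) ^ t else 0 := by
  induction t generalizing b with
  | zero =>
    have : (Finset.univ.filter fun h : Fin (0 + 1) → B =>
        IsTwistedWalk τ 0 h ∧ h 0 = a ∧ h (Fin.last 0) = b) =
        if b = a then {fun _ => a} else ∅ := by
      ext h
      split_ifs with hab
      · subst hab
        simp only [Finset.mem_filter, Finset.mem_univ, true_and, Finset.mem_singleton]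
        constructor
        · rintro ⟨_, h0, _⟩
          funext i
          rw [show i = 0 from Fin.ext (by omega), h0]
        · rintro rfl
          exact ⟨fun i => i.elim0, rfl, rfl⟩
      · simp only [Finset.mem_filter, Finset.mem_univ, true_and, Finset.notMem_empty, iff_false]
        rintro ⟨_, h0, h1⟩
        exact hab (h1.symm.trans h0)
    rw [this]
    by_cases hab : b = a <;> simp [hab, walkCount, permComp]
  | succ t ih =>
    have key : (Finset.univ.filter fun h : Fin (t + 1 + 1) → B =>
        IsTwistedWalk τ (t + 1) h ∧ h 0 = a ∧ h (Fin.last (t + 1)) = b).card =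
        ∑ b' ∈ Finset.univ.erase ((τ t).symm b), (Finset.univ.filter fun h : Fin (t + 1) → B =>
          IsTwistedWalk τ t h ∧ h 0 = a ∧ h (Fin.last t) = b').card := by
      rw [← Finset.card_biUnion]
      · symm
        refine Finset.card_bij (fun h _ => (Fin.snoc h b : Fin (t + 1 + 1) → B)) ?_ ?_ ?_
        · intro h hh
          simp only [Finset.mem_biUnion, Finset.mem_erase, Finset.mem_univ, and_true,
            Finset.mem_filter, true_and] at hh ⊢
          obtain ⟨b', hb', h1, h2, h3⟩ := hh
          refine ⟨(isTwistedWalk_snoc τ t h b).2 ⟨h1, ?_⟩, ?_, ?_⟩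
          · rw [h3]
            intro hb
            exact hb' (by rw [hb, Equiv.symm_apply_apply])
          · rw [← Fin.castSucc_zero, Fin.snoc_castSucc, h2]
          · rw [Fin.snoc_last]
        · intro h _ h' _ heq
          exact (Fin.snoc_injective2 heq).1
        · intro h hh
          simp only [Finset.mem_biUnion, Finset.mem_erase, Finset.mem_univ, and_true,
            Finset.mem_filter, true_and] at hh ⊢
          obtain ⟨h1, h2, h3⟩ := hh
          have hs : (Fin.snoc (Fin.init h) b : Fin (t + 1 + 1) → B) = h := by
            rw [← h3]; exact Fin.snoc_init_self h
          rw [← hs, isTwistedWalk_snoc] at h1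
          refine ⟨Fin.init h, ⟨_, ?_, h1.1, ?_, rfl⟩, hs⟩
          · intro hb
            exact h1.2 (by rw [hb, Equiv.apply_symm_apply])
          · rw [← h2]; rfl
      · intro x _ y _ hxy
        rw [Function.onFun, Finset.disjoint_left]
        intro h hx hy
        simp only [Finset.mem_filter] at hx hy
        exact hxy (hx.2.2.2.symm.trans hy.2.2.2)
    rw [key]
    push_cast
    simp only [ih]
    have hsum : ∑ b' : B, (walkCount q t + if b' = permComp τ t a then (-1 : ℤ) ^ t else 0) =
        (q : ℤ) ^ t := by
      rw [Finset.sum_add_distrib, Finset.sum_ite_eq' Finset.univ, if_pos (Finset.mem_univ _),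
        Finset.sum_const, Finset.card_univ, hB, nsmul_eq_mul]
      push_cast
      rw [succ_mul_walkCount]
      ring
    have herase := Finset.add_sum_erase Finset.univ
      (fun b' : B => walkCount q t + if b' = permComp τ t a then (-1 : ℤ) ^ t else 0)
      (Finset.mem_univ ((τ t).symm b))
    rw [hsum] at herase
    have hiff : (τ t).symm b = permComp τ t a ↔ b = permComp τ (t + 1) a := by
      rw [Equiv.symm_apply_eq]; rfl
    simp only [hiff] at herase
    rw [walkCount]
    by_cases hb : b = permComp τ (t + 1) a
    · simp only [hb, if_true] at herase ⊢
      rw [pow_succ]; linarith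
    · simp only [hb, if_false] at herase ⊢
      linarith

open Classical in
theorem card_twistedCycle {B : Type*} [Fintype B] {q : ℕ} (hB : Fintype.card B = q + 1)
    (τ : ℕ → Equiv.Perm B) (t : ℕ) (Q : B → B → Prop) :
    ((Finset.univ.filter fun h : Fin (t + 1) → B =>
      IsTwistedWalk τ t h ∧ Q (h 0) (h (Fin.last t))).card : ℤ) =
      walkCount q t * (Finset.univ.filter fun x : B × B => Q x.1 x.2).card +
        (-1) ^ t * (Finset.univ.filter fun a : B => Q a (permComp τ t a)).card := by
  have key : (Finset.univ.filter fun h : Fin (t + 1) → B =>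
      IsTwistedWalk τ t h ∧ Q (h 0) (h (Fin.last t))).card =
      ∑ x ∈ Finset.univ.filter (fun x : B × B => Q x.1 x.2),
        (Finset.univ.filter fun h : Fin (t + 1) → B =>
          IsTwistedWalk τ t h ∧ h 0 = x.1 ∧ h (Fin.last t) = x.2).card := by
    rw [Finset.card_eq_sum_card_fiberwise (f := fun h => (h 0, h (Fin.last t)))
      (t := Finset.univ.filter (fun x : B × B => Q x.1 x.2))]
    · refine Finset.sum_congr rfl fun x hx => ?_
      congr 1
      ext h
      simp only [Finset.mem_filter, Finset.mem_univ, true_and] at hx ⊢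
      constructor
      · rintro ⟨⟨h1, h2⟩, rfl⟩
        exact ⟨h1, rfl, rfl⟩
      · rintro ⟨h1, h2, h3⟩
        exact ⟨⟨h1, by rw [h2, h3]; exact hx⟩, Prod.ext h2 h3⟩
    · intro h hh
      simp only [Finset.coe_filter, Finset.mem_univ, true_and, Set.mem_ofPred_eq] at hh ⊢
      exact hh.2
  rw [key]
  push_cast
  simp only [card_twistedWalk hB]
  rw [Finset.sum_add_distrib, Finset.sum_const, nsmul_eq_mul, mul_comm, ← Finset.sum_filter,
    Finset.sum_const, nsmul_eq_mul, mul_comm (_ : ℤ) ((-1 : ℤ) ^ t)]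
  congr 3
  refine Finset.card_bij (fun x _ => x.1) ?_ ?_ ?_
  · rintro ⟨a, b⟩ hx
    simp only [Finset.mem_filter, Finset.mem_univ, true_and] at hx ⊢
    rw [← hx.2]; exact hx.1
  · rintro ⟨a, b⟩ hx ⟨a', b'⟩ hx' heq
    simp only [Finset.mem_filter, Finset.mem_univ, true_and] at hx hx' heq
    rw [hx.2, hx'.2, heq]
  · intro a ha
    simp only [Finset.mem_filter, Finset.mem_univ, true_and] at ha
    exact ⟨(a, permComp τ t a), by simpa using ha, rfl⟩

/-! ### Wheels with a permutation on each rim edge -/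

/-- The permutation of the elements other than `c` that agrees with `σ` wherever `σ` does not
take the value `c`. -/
noncomputable def avoid {A : Type*} (σ : Equiv.Perm A) (c : A) : Equiv.Perm {x // x ≠ c} :=
  haveI := Classical.decEq A
  -- If `σ` moves `c`, the one element that `σ` sends to `c` is redirected to `σ c`.
  (Equiv.swap c (σ c) * σ).subtypePerm fun x => by
    refine not_congr ?_
    rw [Equiv.Perm.mul_apply, ← Equiv.eq_symm_apply, Equiv.symm_swap, Equiv.swap_apply_left,
      σ.apply_eq_iff_eq]

theorem avoid_apply {A : Type*} (σ : Equiv.Perm A) (c : A) (x : {x // x ≠ c}) (hx : σ x ≠ c) :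
    (avoid σ c x : A) = σ x := by
  classical
  simp only [avoid, Equiv.Perm.subtypePerm_apply, Equiv.Perm.mul_apply]
  exact Equiv.swap_apply_of_ne_of_ne hx fun h => x.2 (σ.injective h)

/-- `g` colors the rim of a wheel whose hub has color `c`; consecutive rim vertices are matched
by the permutations `σ`. -/
def IsWheelColoring {A : Type*} {t : ℕ} (σ : Fin (t + 1) → Equiv.Perm A) (c : A)
    (g : Fin (t + 1) → A) : Prop :=
  ∀ j, g j ≠ c ∧ g (j + 1) ≠ σ j (g j)

open Classical in
theorem card_wheelColoring_rotate {A : Type*} [Fintype A] {t : ℕ}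
    (σ : Fin (t + 1) → Equiv.Perm A) (c : A) (r : Fin (t + 1)) :
    (Finset.univ.filter fun g => IsWheelColoring (fun j => σ (j + r)) c g).card =
      (Finset.univ.filter fun g => IsWheelColoring σ c g).card := by
  refine Finset.card_equiv (Equiv.arrowCongr (Equiv.addRight r) (Equiv.refl A)) fun g => ?_
  rw [Finset.mem_filter, Finset.mem_filter]
  simp only [Finset.mem_univ, true_and]
  unfold IsWheelColoring
  conv_rhs => rw [← (Equiv.addRight r).forall_congr_right]
  refine forall_congr' fun j => ?_
  simp [Equiv.arrowCongr, add_right_comm j r 1]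

open Classical in
/-- The colors moved by some of the permutations `σ`. -/
noncomputable def movedColors {A : Type*} [Fintype A] {t : ℕ} (σ : Fin (t + 1) → Equiv.Perm A) :
    Finset A :=
  Finset.univ.filter fun a => ∃ j, σ j a ≠ a

-- For a fixed second entry `b`, the first entry must avoid `σ b`, which leaves `q` of `q + 1`
-- colors; if `σ b = c`, nothing is lost. The latter happens for some `b ≠ c` exactly when `σ` moves
-- `c`.
open Classical in
theorem le_card_closing_pairs {A : Type*} [Fintype A] {q : ℕ}
    (hA : Fintype.card A = q + 2) (σ : Equiv.Perm A) (c : A) :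
    (q + 1) * q + (if σ c ≠ c then 1 else 0) ≤
      (Finset.univ.filter fun x : {x // x ≠ c} × {x // x ≠ c} => (x.1 : A) ≠ σ x.2).card := by
  have hB : Fintype.card {x // x ≠ c} = q + 1 := by
    rw [Fintype.card_subtype_compl, Fintype.card_subtype_eq, hA]; rfl
  have hfib : (Finset.univ.filter fun x : {x // x ≠ c} × {x // x ≠ c} =>
      (x.1 : A) ≠ σ x.2).card = ∑ b : {x // x ≠ c},
        (Finset.univ.filter fun a : {x // x ≠ c} => (a : A) ≠ σ b).card := by
    rw [Finset.card_filter, Fintype.sum_prod_type_right]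
    refine Finset.sum_congr rfl fun b _ => ?_
    rw [Finset.card_filter]
  have hb : ∀ b : {x // x ≠ c}, q + (if σ b = c then 1 else 0) ≤
      (Finset.univ.filter fun a : {x // x ≠ c} => (a : A) ≠ σ b).card := by
    intro b
    split_ifs with h
    · rw [h, Finset.filter_true_of_mem fun a _ => a.2, Finset.card_univ, hB]
    · have : (Finset.univ.filter fun a : {x // x ≠ c} => (a : A) ≠ σ b) =
          Finset.univ.erase ⟨σ b, h⟩ := by
        ext a
        simp [Subtype.ext_iff]
      rw [this, Finset.card_erase_of_mem (Finset.mem_univ _), Finset.card_univ, hB]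
      rfl
  rw [hfib]
  refine le_trans ?_ (Finset.sum_le_sum fun b _ => hb b)
  rw [Finset.sum_add_distrib, Finset.sum_const, Finset.card_univ, hB, smul_eq_mul]
  refine Nat.add_le_add_left ?_ _
  split_ifs with h
  · have hne : σ.symm c ≠ c := fun h' => h (by rw [← h', Equiv.apply_symm_apply, h'])
    refine le_trans ?_ (Finset.single_le_sum (fun _ _ => Nat.zero_le _)
      (Finset.mem_univ (⟨σ.symm c, hne⟩ : {x // x ≠ c})))
    simp
  · exact Nat.zero_le _

open Classical in
theorem exists_le_card_wheelColoring {A : Type*} [Fintype A] {q : ℕ}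
    (hA : Fintype.card A = q + 2) {t : ℕ} (σ : Fin (t + 1) → Equiv.Perm A) (c : A) :
    ∃ X D : ℕ, (q + 1) * q + (if c ∈ movedColors σ then 1 else 0) ≤ X ∧
      D + (if c ∈ movedColors σ then 1 else 0) ≤ (movedColors σ).card ∧
      walkCount q t * X + (-1) ^ t * D ≤
        (Finset.univ.filter fun g => IsWheelColoring σ c g).card := by
  -- Only the closing edge is counted exactly, so the rim is rotated until a permutation that moves
  -- `c`, if any, lies there.
  wlog hlast : c ∈ movedColors σ → σ (Fin.last t) c ≠ c generalizing σ
  · rw [Classical.not_imp] at hlast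
    obtain ⟨hc, -⟩ := hlast
    obtain ⟨j, hj⟩ := (Finset.mem_filter.1 hc).2
    have hm : movedColors (fun i => σ (i + (j - Fin.last t))) = movedColors σ := by
      ext a
      simp only [movedColors, Finset.mem_filter, Finset.mem_univ, true_and]
      exact ⟨fun ⟨i, hi⟩ => ⟨_, hi⟩, fun ⟨i, hi⟩ => ⟨i - (j - Fin.last t), by simpa using hi⟩⟩
    have := this (fun i => σ (i + (j - Fin.last t))) fun _ => by simpa using hj
    rwa [hm, card_wheelColoring_rotate] at this
  have hB : Fintype.card {x // x ≠ c} = q + 1 := by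
    rw [Fintype.card_subtype_compl, Fintype.card_subtype_eq, hA]; rfl
  let σ' : ℕ → Equiv.Perm A := fun i => if h : i < t + 1 then σ ⟨i, h⟩ else 1
  let τ : ℕ → Equiv.Perm {x // x ≠ c} := fun i => avoid (σ' i) c
  refine ⟨(Finset.univ.filter fun x : {x // x ≠ c} × {x // x ≠ c} =>
    (x.1 : A) ≠ σ (Fin.last t) x.2).card, (Finset.univ.filter fun a : {x // x ≠ c} =>
    (a : A) ≠ σ (Fin.last t) (permComp τ t a)).card, ?_, ?_, ?_⟩
  rotate_left 2
  · have hcycle := card_twistedCycle hB τ t (fun a b => (a : A) ≠ σ (Fin.last t) b)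
    refine le_of_eq_of_le (Eq.trans ?_ hcycle.symm) ?_
    · congr!
    -- `avoid` forbids everything that `σ` forbids among colors other than `c`, and possibly more,
    -- so these walks inject into the wheel colorings.
    refine Nat.cast_le.2 (Finset.card_le_card_of_injOn (fun h i => (h i : A)) ?_ ?_)
    · intro h hh
      simp only [Finset.coe_filter, Finset.mem_univ, true_and, Set.mem_ofPred_eq] at hh ⊢
      intro j
      refine ⟨(h j).2, ?_⟩
      induction j using Fin.lastCases with
      | last => rw [Fin.last_add_one]; exact hh.2
      | cast i =>
        rw [Fin.coeSucc_eq_succ]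
        intro heq
        have hσ : σ' i = σ i.castSucc := by
          simp only [σ']
          rw [dif_pos (by omega)]
          rfl
        refine hh.1 i (Subtype.ext ?_)
        rw [avoid_apply, hσ]
        · exact heq
        · rw [hσ, ← heq]
          exact (h i.succ).2
    · intro h _ h' _ heq
      funext i
      exact Subtype.ext (congrFun heq i)
  · refine le_trans (Nat.add_le_add_left ?_ _)
      (le_card_closing_pairs hA (σ (Fin.last t)) c)
    split_ifs with h1 h2 h2
    · exact le_rfl
    · exact absurd (hlast h1) h2
    all_goals exact Nat.zero_le _
  -- A color fixed by every `σ j` returns to itself around the rim, so only moved colors other than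
  -- `c` count in `D`.
  · have hD : (Finset.univ.filter fun a : {x // x ≠ c} =>
        (a : A) ≠ σ (Fin.last t) (permComp τ t a)).card ≤ ((movedColors σ).erase c).card := by
      refine Finset.card_le_card_of_injOn Subtype.val ?_ Subtype.val_injective.injOn
      intro a ha
      simp only [Finset.coe_filter, Finset.mem_univ, true_and, Set.mem_ofPred_eq] at ha
      rw [Finset.mem_coe, Finset.mem_erase]
      refine ⟨a.2, ?_⟩
      by_contra hm
      simp only [movedColors, Finset.mem_filter, Finset.mem_univ, true_and, not_exists,
        not_not] at hm
      refine ha ?_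
      rw [permComp_fixed τ t, hm]
      intro i hi
      have hσ : σ' i a = a := by
        simp only [σ']
        rw [dif_pos (by omega), hm]
      refine Subtype.ext ?_
      rw [avoid_apply, hσ]
      rw [hσ]
      exact a.2
    split_ifs with h
    · have := Finset.card_erase_add_one h
      omega
    · rw [Finset.erase_eq_of_notMem h] at hD
      exact hD

open Classical in
/-- A wheel has at least as many colorings from matchings as it has proper colorings. -/
theorem le_card_wheelColorings {A : Type*} [Fintype A] {q : ℕ} (hq : 2 ≤ q)
    (hA : Fintype.card A = q + 2) {t : ℕ} (ht : 2 ≤ t) (σ : Fin (t + 1) → Equiv.Perm A) :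
    ((q : ℤ) + 2) * ((q + 1) * q * walkCount q t) ≤
      ∑ c, (Finset.univ.filter fun g => IsWheelColoring σ c g).card := by
  have he := walkCount_nonneg (by omega : 1 ≤ q) t
  push_cast
  have hcard : ((q : ℤ) + 2) = (Finset.univ : Finset A).card := by
    rw [Finset.card_univ, hA]; push_cast; rfl
  rcases Nat.even_or_odd t with hev | hodd
  -- The term with `D` has a positive sign, so the bound holds for each hub color separately.
  · rw [hcard, ← nsmul_eq_mul, ← Finset.sum_const]
    refine Finset.sum_le_sum fun c _ => ?_
    obtain ⟨X, D, hX, -, h⟩ := exists_le_card_wheelColoring hA σ c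
    rw [hev.neg_one_pow] at h
    have hX' : ((q : ℤ) + 1) * q ≤ X := by exact_mod_cast (Nat.le_add_right _ _).trans hX
    nlinarith [mul_le_mul_of_nonneg_left hX' he]
  · have ht3 : 3 ≤ t := by
      obtain ⟨s, rfl⟩ := hodd
      omega
    have hle := le_walkCount hq ht3 hodd
    set U := movedColors σ
    -- Summed over `c`, the loss is `(q + 2) * |U|` and the gain `(walkCount q t + 1) * |U|`.
    have hc : ∀ c ∈ (Finset.univ : Finset A),
        ((q : ℤ) + 1) * q * walkCount q t - U.card +
          (if c ∈ U then (walkCount q t + 1) else 0) ≤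
        ((Finset.univ.filter fun g => IsWheelColoring σ c g).card : ℤ) := by
      intro c _
      obtain ⟨X, D, hX, hD, h⟩ := exists_le_card_wheelColoring hA σ c
      rw [hodd.neg_one_pow] at h
      zify at hX hD
      have := mul_le_mul_of_nonneg_left hX he
      change _ + (if c ∈ U then _ else _) ≤ _ at hD
      change _ * (_ + (if c ∈ U then _ else _)) ≤ _ at this
      split_ifs at hD this ⊢ <;> linarith
    refine le_trans ?_ (Finset.sum_le_sum hc)
    rw [Finset.sum_add_distrib, Finset.sum_const, nsmul_eq_mul, ← hcard, ← Finset.sum_filter,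
      Finset.sum_const, nsmul_eq_mul, Finset.filter_mem_eq_inter, Finset.univ_inter]
    nlinarith [mul_le_mul_of_nonneg_left hle (Int.natCast_nonneg U.card)]

/-! ### From wheels to joins with lists -/

/-- The pairs in `R` between `X` and `Y` form a matching. -/
def IsListMatching {W : Type*} (R : W → W → Prop) (X Y : Finset W) : Prop :=
  (∀ x ∈ X, ∀ y ∈ Y, ∀ z ∈ Y, R x y → R x z → y = z) ∧
    ∀ x ∈ X, ∀ z ∈ X, ∀ y ∈ Y, R x y → R z y → x = z

theorem IsListMatching.mono {W : Type*} {R : W → W → Prop} {X Y X' Y' : Finset W}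
    (h : IsListMatching R X Y) (hX : X' ⊆ X) (hY : Y' ⊆ Y) : IsListMatching R X' Y' :=
  ⟨fun x hx y hy z hz => h.1 x (hX hx) y (hY hy) z (hY hz),
    fun x hx z hz y hy => h.2 x (hX hx) z (hX hz) y (hY hy)⟩

/-- A partial matching between lists of equal size extends to a bijection. One implication suffices,
since extra forbidden pairs only lower the count. -/
theorem IsListMatching.exists_equiv {W : Type*} {R : W → W → Prop} {X Y : Finset W}
    (h : IsListMatching R X Y) (hcard : X.card = Y.card) :
    ∃ e : X ≃ Y, ∀ (x : X) (y : Y), R x y → e x = y := by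
  classical
  let f : X → W := fun x => if hx : ∃ y ∈ Y, R x y then hx.choose else x
  have hf : ∀ x : X, (∃ y ∈ Y, R x y) → f x ∈ Y ∧ R x (f x) := by
    intro x hx
    simp only [f]
    rw [dif_pos hx]
    exact hx.choose_spec
  obtain ⟨e, he⟩ := Finset.exists_equiv_extend_of_card_eq (t := Y)
    (s := Finset.univ.filter fun x : X => ∃ y ∈ Y, R x y) (f := f)
    (by rw [Fintype.card_coe, hcard])
    (by
      intro y hy
      obtain ⟨x, hx, rfl⟩ := Finset.mem_image.1 hy
      exact (hf x (Finset.mem_filter.1 hx).2).1)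
    (by
      intro x hx z hz hxz
      have h1 := hf x (Finset.mem_filter.1 hx).2
      have h2 := hf z (Finset.mem_filter.1 hz).2
      rw [← hxz] at h2
      exact Subtype.ext (h.2 x x.2 z z.2 _ h1.1 h1.2 h2.2))
  refine ⟨e, fun x y hxy => Subtype.ext ?_⟩
  have hx : ∃ y ∈ Y, R x y := ⟨y, y.2, hxy⟩
  rw [he x (Finset.mem_filter.2 ⟨Finset.mem_univ _, hx⟩)]
  exact h.1 x x.2 _ (hf x hx).1 _ y.2 (hf x hx).2 hxy

open Classical in
/-- The ways to choose colors for the vertices of a complete graph from the lists `S` and for the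
vertices of a cycle from the lists `T` such that no two colors chosen at adjacent vertices of the
join are in relation `R`. -/
noncomputable def joinColorings {W : Type*} {p t : ℕ} (R : W → W → Prop) (S : Fin p → Finset W)
    (T : Fin (t + 1) → Finset W) : Finset ((Fin p → W) × (Fin (t + 1) → W)) :=
  (Fintype.piFinset S ×ˢ Fintype.piFinset T).filter fun x =>
    (∀ i j, i < j → ¬ R (x.1 i) (x.1 j)) ∧ (∀ i j, ¬ R (x.1 i) (x.2 j)) ∧
      ∀ j, ¬ R (x.2 j) (x.2 (j + 1))

theorem mem_joinColorings {W : Type*} {p t : ℕ} {R : W → W → Prop} {S : Fin p → Finset W}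
    {T : Fin (t + 1) → Finset W} {x : (Fin p → W) × (Fin (t + 1) → W)} :
    x ∈ joinColorings R S T ↔ ((∀ i, x.1 i ∈ S i) ∧ ∀ j, x.2 j ∈ T j) ∧
      (∀ i j, i < j → ¬ R (x.1 i) (x.1 j)) ∧ (∀ i j, ¬ R (x.1 i) (x.2 j)) ∧
      ∀ j, ¬ R (x.2 j) (x.2 (j + 1)) := by
  simp only [joinColorings, Finset.mem_filter, Finset.mem_product, Fintype.mem_piFinset]

theorem joinColorings_mono {W : Type*} {p t : ℕ} {R : W → W → Prop} {S S' : Fin p → Finset W}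
    {T T' : Fin (t + 1) → Finset W} (hS : ∀ i, S' i ⊆ S i) (hT : ∀ j, T' j ⊆ T j) :
    joinColorings R S' T' ⊆ joinColorings R S T := by
  intro x hx
  rw [mem_joinColorings] at hx ⊢
  exact ⟨⟨fun i => hS i (hx.1.1 i), fun j => hT j (hx.1.2 j)⟩, hx.2⟩

theorem le_card_joinColorings_wheel_of_card_eq {W : Type*} {R : W → W → Prop} {q t : ℕ}
    (hq : 2 ≤ q) (ht : 2 ≤ t) {S : Fin 1 → Finset W} {T : Fin (t + 1) → Finset W}
    (hST : ∀ i j, IsListMatching R (S i) (T j))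
    (hTT : ∀ j, IsListMatching R (T j) (T (j + 1)))
    (hS : ∀ i, (S i).card = q + 2) (hT : ∀ j, (T j).card = q + 2) :
    ((q : ℤ) + 2) * ((q + 1) * q * walkCount q t) ≤ (joinColorings R S T).card := by
  classical
  choose e he using fun j => (hST 0 j).exists_equiv ((hS 0).trans (hT j).symm)
  choose d hd using fun j => (hTT j).exists_equiv ((hT j).trans (hT (j + 1)).symm)
  -- The spoke bijections `e j` name rim colors by hub colors; the rim bijections are conjugated
  -- accordingly.
  refine (le_card_wheelColorings hq (A := S 0) (by rw [Fintype.card_coe, hS]) ht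
    fun j => ((e j).trans (d j)).trans (e (j + 1)).symm).trans ?_
  rw [← Finset.card_sigma]
  refine Nat.cast_le.2 (Finset.card_le_card_of_injOn
    (fun x => (fun _ => (x.1 : W), fun j => (e j (x.2 j) : W))) ?_ ?_)
  · rintro ⟨c, g⟩ hx
    rw [Finset.mem_coe, Finset.mem_sigma, Finset.mem_filter] at hx
    have hg := hx.2.2
    rw [Finset.mem_coe, mem_joinColorings]
    refine ⟨⟨fun i => ?_, fun j => (e j (g j)).2⟩, ?_, ?_, ?_⟩
    · rw [Subsingleton.elim i 0]
      exact c.2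
    · intro i j hij
      exact absurd hij (by rw [Subsingleton.elim i j]; exact lt_irrefl _)
    · intro _ j hR
      exact (hg j).1 ((e j).injective (he j c _ hR)).symm
    · intro j hR
      have h1 : d j (e j (g j)) = e (j + 1) (g (j + 1)) := hd j _ _ hR
      refine (hg j).2 ?_
      rw [Equiv.trans_apply, Equiv.trans_apply, h1, Equiv.symm_apply_apply]
  · rintro ⟨c, g⟩ _ ⟨c', g'⟩ _ heq
    simp only [Prod.mk.injEq] at heq
    have h1 : c = c' := Subtype.ext (congrFun heq.1 0)
    have h2 : g = g' := funext fun j => (e j).injective (Subtype.ext (congrFun heq.2 j))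
    rw [h1, h2]

theorem le_card_joinColorings_wheel {W : Type*} {R : W → W → Prop} {q t : ℕ}
    (hq : 2 ≤ q) (ht : 2 ≤ t) {S : Fin 1 → Finset W} {T : Fin (t + 1) → Finset W}
    (hST : ∀ i j, IsListMatching R (S i) (T j))
    (hTT : ∀ j, IsListMatching R (T j) (T (j + 1)))
    (hS : ∀ i, q + 2 ≤ (S i).card) (hT : ∀ j, q + 2 ≤ (T j).card) :
    ((q : ℤ) + 2) * ((q + 1) * q * walkCount q t) ≤ (joinColorings R S T).card := by
  choose S' hS' hSc using fun i => Finset.exists_subset_card_eq (hS i)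
  choose T' hT' hTc using fun j => Finset.exists_subset_card_eq (hT j)
  exact (le_card_joinColorings_wheel_of_card_eq hq ht
    (fun i j => (hST i j).mono (hS' i) (hT' j)) (fun j => (hTT j).mono (hT' j) (hT' (j + 1)))
    hSc hTc).trans (Nat.cast_le.2 (Finset.card_le_card (joinColorings_mono hS' hT')))

open Classical in
/-- Choosing a color at the first vertex of the complete graph removes the matched colors from
all other lists. -/
theorem sum_card_joinColorings_le {W : Type*} {R : W → W → Prop} {p t : ℕ}
    (S : Fin (p + 1) → Finset W) (T : Fin (t + 1) → Finset W) :
    ∑ x ∈ S 0, (joinColorings R (fun i => (S i.succ).filter fun y => ¬ R x y)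
      (fun j => (T j).filter fun y => ¬ R x y)).card ≤ (joinColorings R S T).card := by
  rw [← Finset.card_sigma]
  refine Finset.card_le_card_of_injOn
    (fun x => ((Fin.cons x.1 x.2.1 : Fin (p + 1) → W), x.2.2)) ?_ ?_
  · rintro ⟨x, f, g⟩ hx
    rw [Finset.mem_coe, Finset.mem_sigma, mem_joinColorings] at hx
    simp only [Finset.mem_filter] at hx
    obtain ⟨hx0, ⟨hf, hg⟩, h1, h2, h3⟩ := hx
    rw [Finset.mem_coe, mem_joinColorings]
    refine ⟨⟨?_, fun j => (hg j).1⟩, ?_, ?_, h3⟩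
    · intro i
      induction i using Fin.cases with
      | zero => simpa using hx0
      | succ i => simpa using (hf i).1
    · intro i j hij
      induction j using Fin.cases with
      | zero => exact absurd hij (Fin.not_lt_zero _)
      | succ j =>
        induction i using Fin.cases with
        | zero => simpa using (hf j).2
        | succ i => simpa using h1 i j (Fin.succ_lt_succ_iff.1 hij)
    · intro i j
      induction i using Fin.cases with
      | zero => simpa using (hg j).2
      | succ i => simpa using h2 i j
  · rintro ⟨x, f, g⟩ _ ⟨x', f', g'⟩ _ heq
    simp only [Prod.mk.injEq] at heq
    obtain ⟨h1, h2⟩ := Fin.cons_injective2 heq.1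
    rw [h1, h2, heq.2]

theorem IsListMatching.le_card_filter_not {W : Type*} {R : W → W → Prop} {X Y : Finset W}
    (h : IsListMatching R X Y) {x : W} (hx : x ∈ X) [DecidablePred fun y => ¬ R x y] {m : ℕ}
    (hY : m + 1 ≤ Y.card) : m ≤ (Y.filter fun y => ¬ R x y).card := by
  classical
  have h1 : (Y.filter fun y => R x y).card ≤ 1 := by
    refine Finset.card_le_one.2 fun y hy z hz => ?_
    rw [Finset.mem_filter] at hy hz
    exact h.1 x hx y hy.1 z hz.1 hy.2 hz.2
  have h2 := Finset.card_filter_add_card_filter_not (s := Y) (fun y => R x y)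

  have h4 : m ≤ Y.card - (Y.filter fun y => R x y).card := by omega
  convert h4.trans (by omega : _ ≤ (Y.filter fun y => ¬ R x y).card)

/-- Each color chosen in the complete graph shortens the other lists by at most one, so the choices
multiply to a falling factorial. The lists are bounded only from below because unmatched colors
survive. -/
theorem le_card_joinColorings {W : Type*} {R : W → W → Prop} {q t : ℕ}
    (hq : 2 ≤ q) (ht : 2 ≤ t) (r : ℕ) {S : Fin (r + 1) → Finset W} {T : Fin (t + 1) → Finset W}
    (hSS : ∀ i j, i < j → IsListMatching R (S i) (S j))
    (hST : ∀ i j, IsListMatching R (S i) (T j))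
    (hTT : ∀ j, IsListMatching R (T j) (T (j + 1)))
    (hS : ∀ i, q + 2 + r ≤ (S i).card) (hT : ∀ j, q + 2 + r ≤ (T j).card) :
    ((q + 2 + r).descFactorial (r + 1) : ℤ) * ((q + 1) * q * walkCount q t) ≤
      (joinColorings R S T).card := by
  classical
  induction r generalizing T with
  | zero => simpa using le_card_joinColorings_wheel hq ht hST hTT hS hT
  | succ r ih =>
    refine le_trans ?_ (Nat.cast_le.2 (sum_card_joinColorings_le S T))
    have hnn := walkCount_nonneg (by omega : 1 ≤ q) t
    have hx : ∀ x ∈ S 0, ((q + 2 + r).descFactorial (r + 1) : ℤ) *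
        ((q + 1) * q * walkCount q t) ≤
        ((joinColorings R (fun i : Fin (r + 1) => (S i.succ).filter fun y => ¬ R x y)
          (fun j => (T j).filter fun y => ¬ R x y)).card : ℤ) := fun x hx =>
      ih (fun i j hij => (hSS i.succ j.succ (Fin.succ_lt_succ_iff.2 hij)).mono
          (Finset.filter_subset _ _) (Finset.filter_subset _ _))
        (fun i j => (hST i.succ j).mono (Finset.filter_subset _ _) (Finset.filter_subset _ _))
        (fun j => (hTT j).mono (Finset.filter_subset _ _) (Finset.filter_subset _ _))
        (fun i => (hSS 0 i.succ (Fin.succ_pos i)).le_card_filter_not hx (hS i.succ))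
        (fun j => (hST 0 j).le_card_filter_not hx (hT j))
    push_cast
    refine le_trans ?_ (Finset.sum_le_sum hx)
    rw [Finset.sum_const, nsmul_eq_mul, show q + 2 + (r + 1) = q + 2 + r + 1 by ring,
      Nat.succ_descFactorial_succ, Nat.cast_mul, mul_assoc]
    exact mul_le_mul_of_nonneg_right (Nat.cast_le.2 (hS 0)) (by positivity)

/-! ### Proper colorings of the join -/

theorem completeJoinCycle_adj_inl_inl {p n : ℕ} {i j : Fin p} :
    (completeJoinCycle p n).Adj (Sum.inl i) (Sum.inl j) ↔ i ≠ j := by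
  simp [completeJoinCycle, join]

theorem completeJoinCycle_adj_inl_inr {p n : ℕ} (i : Fin p) (j : Fin n) :
    (completeJoinCycle p n).Adj (Sum.inl i) (Sum.inr j) := by
  simp [completeJoinCycle, join]

theorem completeJoinCycle_adj_inr_inr {p t : ℕ} (ht : 1 ≤ t) {i j : Fin (t + 1)} :
    (completeJoinCycle p (t + 1)).Adj (Sum.inr i) (Sum.inr j) ↔ j = i + 1 ∨ i = j + 1 := by
  obtain ⟨s, rfl⟩ := Nat.exists_eq_add_of_le' ht
  simp only [completeJoinCycle, join, SimpleGraph.sup_adj, SimpleGraph.sum_adj_inr,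
    completeBipartiteGraph_adj, Sum.isLeft_inr, Sum.isRight_inr, Bool.false_eq_true, false_and,
    and_false, or_false, SimpleGraph.cycleGraph_adj]
  rw [or_comm, sub_eq_iff_eq_add, sub_eq_iff_eq_add, add_comm 1 i, add_comm 1 j]

theorem card_cycle_colorings {B : Type*} [Fintype B] {q : ℕ} (hB : Fintype.card B = q + 1)
    (t : ℕ) :
    (Nat.card {g : Fin (t + 1) → B // ∀ j, g (j + 1) ≠ g j} : ℤ) =
      (q + 1) * q * walkCount q t := by
  classical
  have h := card_twistedCycle hB (fun _ => 1) t (fun a b => a ≠ b)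
  have hcomp : permComp (fun _ => (1 : Equiv.Perm B)) t = 1 :=
    Equiv.ext fun a => permComp_fixed _ t fun _ _ => rfl
  have hoff : (Finset.univ.filter fun x : B × B => x.1 ≠ x.2).card = (q + 1) * q := by
    have := Finset.offDiag_card (Finset.univ : Finset B)
    rw [Finset.card_univ, hB] at this
    rw [show (q + 1) * q = (q + 1) * (q + 1) - (q + 1) by rw [Nat.mul_succ, Nat.add_sub_cancel],
      ← this]
    congr 1
    ext x
    simp [Finset.mem_offDiag]
  rw [Nat.card_eq_fintype_card, Fintype.card_subtype]
  have hset : (Finset.univ.filter fun g : Fin (t + 1) → B => ∀ j, g (j + 1) ≠ g j) =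
      Finset.univ.filter fun g : Fin (t + 1) → B =>
        IsTwistedWalk (fun _ => 1) t g ∧ g 0 ≠ g (Fin.last t) := by
    ext g
    rw [Finset.mem_filter, Finset.mem_filter, IsTwistedWalk, Fin.forall_fin_succ',
      Fin.last_add_one]
    simp only [Fin.coeSucc_eq_succ, Equiv.Perm.one_apply]
  rw [hset]
  refine Eq.trans (by congr!) (h.trans ?_)
  -- With trivial permutations every color returns to itself, so the signed term vanishes.
  have hdiag : (Finset.univ.filter fun a : B => a ≠ permComp (fun _ => 1) t a).card = 0 := by
    simp [hcomp]
  have e1 : ((Finset.univ.filter fun x : B × B => x.1 ≠ x.2).card : ℤ) = (q + 1) * q := by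
    rw [hoff]; push_cast; rfl
  rw [mul_comm (((q : ℤ) + 1) * q), ← e1]
  convert add_zero _ using 2
  · rw [mul_eq_zero]
    right
    rw [Nat.cast_eq_zero]
    convert hdiag
  · congr!

/-- A proper coloring of the join of a complete graph and a cycle is an injective coloring of the
complete graph together with a coloring of the cycle by the remaining colors. -/
noncomputable def completeJoinCycleColoringEquiv {p t : ℕ} (ht : 1 ≤ t) (α : Type*) :
    (completeJoinCycle p (t + 1)).Coloring α ≃
      Σ f : Fin p ↪ α, {g : Fin (t + 1) → {x // x ∉ Set.range f} // ∀ j, g (j + 1) ≠ g j} where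
  toFun c :=
    ⟨⟨fun i => c (Sum.inl i), fun i j hij => by
        by_contra hne
        exact c.valid (completeJoinCycle_adj_inl_inl.2 hne) hij⟩,
      fun j => ⟨c (Sum.inr j), by
        rintro ⟨i, hi⟩
        exact c.valid (completeJoinCycle_adj_inl_inr i j) hi⟩,
      fun j hj => c.valid ((completeJoinCycle_adj_inr_inr ht).2 (Or.inr rfl))
        (congrArg Subtype.val hj)⟩
  invFun x := SimpleGraph.Coloring.mk (Sum.elim x.1 fun j => x.2.1 j) (by
    rintro (i | i) (j | j) hij
    · exact fun h => completeJoinCycle_adj_inl_inl.1 hij (x.1.injective h)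
    · exact fun h => (x.2.1 j).2 ⟨i, h⟩
    · exact fun h => (x.2.1 i).2 ⟨j, h.symm⟩
    · rcases (completeJoinCycle_adj_inr_inr ht).1 hij with rfl | rfl
      · exact fun h => x.2.2 i (Subtype.ext h.symm)
      · exact fun h => x.2.2 j (Subtype.ext h))
  left_inv c := by
    refine DFunLike.ext _ _ ?_
    rintro (i | j) <;> rfl
  right_inv x := rfl

theorem numProperColorings_completeJoinCycle {p t q : ℕ} (ht : 1 ≤ t) :
    (numProperColorings (completeJoinCycle p (t + 1)) (q + 1 + p) : ℤ) =
      ((q + 1 + p).descFactorial p : ℤ) * ((q + 1) * q * walkCount q t) := by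
  classical
  rw [numProperColorings, Nat.card_congr (completeJoinCycleColoringEquiv ht _), Nat.card_sigma]
  push_cast
  have h : ∀ f : Fin p ↪ Fin (q + 1 + p),
      (Nat.card {g : Fin (t + 1) → {x // x ∉ Set.range f} // ∀ j, g (j + 1) ≠ g j} : ℤ) =
        (q + 1) * q * walkCount q t := by
    intro f
    refine card_cycle_colorings ?_ t
    rw [Fintype.card_subtype_compl, Fintype.card_fin]
    have : Fintype.card {x // x ∈ Set.range f} = p := by
      exact (Fintype.card_congr (Equiv.ofInjective f f.injective)).symm.trans (Fintype.card_fin p)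
    rw [this, Nat.add_sub_cancel]
  simp only [h]
  rw [Finset.sum_const, Finset.card_univ, Fintype.card_embedding_eq, Fintype.card_fin,
    Fintype.card_fin, nsmul_eq_mul]

/-! ### Colorings of covers as transversals -/

section Cover

variable {V W : Type*} {G : SimpleGraph V} (C : Cover G W)

theorem Cover.eq_of_mem {u v : V} {x : W} (hu : x ∈ C.L u) (hv : x ∈ C.L v) : u = v :=
  (C.partition x).unique hu hv

open Classical in
theorem Cover.image_mem_colorings [Fintype V] {f : V → W} (hf : ∀ u, f u ∈ C.L u)
    (hind : ∀ u v, G.Adj u v → ¬ C.H.Adj (f u) (f v)) : Finset.univ.image f ∈ C.colorings := by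
  refine ⟨?_, ?_⟩
  · intro x hx y hy hne hadj
    simp only [Finset.coe_image, Finset.coe_univ, Set.image_univ, Set.mem_range] at hx hy
    obtain ⟨u, rfl⟩ := hx
    obtain ⟨v, rfl⟩ := hy
    rcases C.cross u v _ _ (hf u) (hf v) hadj with rfl | huv
    · exact hne rfl
    · exact hind u v huv hadj
  · rw [Finset.card_image_of_injective, Finset.card_univ]
    intro u v huv
    exact C.eq_of_mem (hf u) (huv ▸ hf v)

open Classical in
theorem Cover.eq_of_image_eq [Fintype V] {f g : V → W} (hf : ∀ u, f u ∈ C.L u) (hg : ∀ u, g u ∈ C.L u)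
    (h : Finset.univ.image f = Finset.univ.image g) : f = g := by
  funext u
  have hu : f u ∈ Finset.univ.image g := h ▸ Finset.mem_image_of_mem f (Finset.mem_univ u)
  obtain ⟨v, -, hv⟩ := Finset.mem_image.1 hu
  have : v = u := C.eq_of_mem (hg v) (hv ▸ hf u)
  rw [← hv, this]

-- The parts are cliques, so an independent set meets each at most once; having `|V|` elements, it
-- meets each exactly once.
open Classical in
theorem Cover.exists_transversal [Fintype V] {I : Finset W} (hI : I ∈ C.colorings) :
    ∃ f : V → W, (∀ u, f u ∈ C.L u) ∧ (∀ u v, ¬ C.H.Adj (f u) (f v)) ∧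
      Finset.univ.image f = I := by
  obtain ⟨hind, hcard⟩ := hI
  have hno : ∀ x ∈ I, ∀ y ∈ I, ¬ C.H.Adj x y := fun x hx y hy hadj =>
    hind hx hy hadj.ne hadj
  choose r hr using fun x => (C.partition x).exists
  have hinj : Set.InjOn r I := by
    intro x hx y hy hxy
    by_contra hne
    exact hno x hx y hy (C.complete (r x) (hr x) (hxy ▸ hr y) hne)
  have himg : I.image r = Finset.univ := by
    rw [← Finset.card_eq_iff_eq_univ, Finset.card_image_of_injOn hinj, hcard]
  have hex : ∀ u, ∃ x ∈ I, r x = u := fun u =>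
    Finset.mem_image.1 (himg ▸ Finset.mem_univ u)
  choose f hfI hf using hex
  refine ⟨f, fun u => ?_, fun u v => hno _ (hfI u) _ (hfI v), ?_⟩
  · have := hr (f u)
    rwa [hf u] at this
  · ext x
    simp only [Finset.mem_image, Finset.mem_univ, true_and]
    refine ⟨fun ⟨u, hu⟩ => hu ▸ hfI u, fun hx => ⟨r x, hinj (hfI _) hx (hf _)⟩⟩

theorem Cover.isListMatching {u v : V} (huv : G.Adj u v) {X Y : Finset W} (hX : ↑X ⊆ C.L u)
    (hY : ↑Y ⊆ C.L v) : IsListMatching C.H.Adj X Y :=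
  ⟨fun x hx y hy z hz => C.matching u v huv x (hX hx) y (hY hy) z (hY hz),
    fun x hx z hz y hy hxy hzy => C.matching v u huv.symm y (hY hy) x (hX hx) z (hX hz)
      hxy.symm hzy.symm⟩

end Cover

theorem le_numColorings_completeJoinCycle {r t q : ℕ} (hq : 2 ≤ q) (ht : 2 ≤ t) {W : Type*}
    (C : Cover (completeJoinCycle (r + 1) (t + 1)) W) (hC : C.IsFold (q + 2 + r)) :
    ((q + 2 + r).descFactorial (r + 1) : ℤ) * ((q + 1) * q * walkCount q t) ≤
      C.numColorings := by
  classical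
  have hfin : ∀ u, (C.L u).Finite := fun u => Set.finite_of_encard_eq_coe (hC u)
  -- Finiteness matters because `ncard` of an infinite set would be `0`.
  have hW : Finite W := by
    refine Set.finite_univ_iff.1 ((Set.finite_iUnion hfin).subset fun x _ => ?_)
    obtain ⟨u, hu⟩ := (C.partition x).exists
    exact Set.mem_iUnion.2 ⟨u, hu⟩
  let S : Fin (r + 1) → Finset W := fun i => (hfin (Sum.inl i)).toFinset
  let T : Fin (t + 1) → Finset W := fun j => (hfin (Sum.inr j)).toFinset
  have hcard : ∀ u, (hfin u).toFinset.card = q + 2 + r := fun u => by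
    have := hC u
    rw [(hfin u).encard_eq_coe_toFinset_card] at this
    exact_mod_cast this
  have hsub : ∀ u, ((hfin u).toFinset : Set W) ⊆ C.L u := fun u => by simp
  have key := le_card_joinColorings (R := C.H.Adj) hq ht r (S := S) (T := T)
    (fun i j hij => C.isListMatching (completeJoinCycle_adj_inl_inl.2 hij.ne) (hsub _) (hsub _))
    (fun i j => C.isListMatching (completeJoinCycle_adj_inl_inr i j) (hsub _) (hsub _))
    (fun j => C.isListMatching ((completeJoinCycle_adj_inr_inr (by omega)).2 (Or.inl rfl))
      (hsub _) (hsub _))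
    (fun i => (hcard _).ge) (fun j => (hcard _).ge)
  refine key.trans (Nat.cast_le.2 ?_)
  have hmem : ∀ x ∈ joinColorings C.H.Adj S T, ∀ u, Sum.elim x.1 x.2 u ∈ C.L u := by
    intro x hx u
    rw [mem_joinColorings] at hx
    rcases u with i | j
    · exact (hfin _).mem_toFinset.1 (hx.1.1 i)
    · exact (hfin _).mem_toFinset.1 (hx.1.2 j)
  have hinj : Set.InjOn (fun x : (Fin (r + 1) → W) × (Fin (t + 1) → W) =>
      Finset.univ.image (Sum.elim x.1 x.2)) (joinColorings C.H.Adj S T) := by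
    intro x hx y hy hxy
    have := C.eq_of_image_eq (hmem x hx) (hmem y hy) hxy
    exact Prod.ext (funext fun i => congrFun this (Sum.inl i))
      (funext fun j => congrFun this (Sum.inr j))
  rw [← Finset.card_image_of_injOn hinj, ← Set.ncard_coe_finset]
  refine Set.ncard_le_ncard ?_ (Set.toFinite _)
  intro I hI
  obtain ⟨x, hx, rfl⟩ := Finset.mem_image.1 (Finset.mem_coe.1 hI)
  refine C.image_mem_colorings (hmem x hx) ?_
  obtain ⟨-, h1, h2, h3⟩ := mem_joinColorings.1 hx
  rintro (i | i) (j | j) hij hadj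
  · rcases lt_or_gt_of_ne (completeJoinCycle_adj_inl_inl.1 hij) with h | h
    · exact h1 i j h hadj
    · exact h1 j i h hadj.symm
  · exact h2 i j hadj
  · exact h2 j i hadj.symm
  · rcases (completeJoinCycle_adj_inr_inr (by omega)).1 hij with rfl | rfl
    · exact h3 i hadj
    · exact h3 j hadj.symm

/-! ### The trivial cover and the DP color function -/

/-- The `m`-fold cover of `G` in which equal colors of adjacent vertices are matched. -/
def trivialCover {V : Type*} (G : SimpleGraph V) {m : ℕ} (hm : 0 < m) : Cover G (V × Fin m) where
  H :=
    { Adj := fun x y => (x.1 = y.1 ∧ x.2 ≠ y.2) ∨ (G.Adj x.1 y.1 ∧ x.2 = y.2)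
      symm := ⟨fun _ _ h => h.imp (fun h => ⟨h.1.symm, h.2.symm⟩) fun h => ⟨h.1.symm, h.2.symm⟩⟩
      loopless := ⟨fun _ h => h.elim (fun h => h.2 rfl) fun h => h.1.ne rfl⟩ }
  L := fun u => {x | x.1 = u}
  nonempty := fun u => ⟨(u, ⟨0, hm⟩), rfl⟩
  partition := fun x => ⟨x.1, rfl, fun _ h => h.symm⟩
  complete := by
    rintro u x rfl y hy hne
    exact Or.inl ⟨hy.symm, fun h => hne (Prod.ext hy.symm h)⟩
  cross := by
    rintro u v x y rfl rfl h
    exact h.imp And.left And.left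
  matching := by
    rintro u v huv x rfl y rfl z hz h h'
    rcases h with ⟨h1, _⟩ | ⟨_, h2⟩
    · exact absurd h1 huv.ne
    rcases h' with ⟨g1, _⟩ | ⟨_, g2⟩
    · exact absurd (g1.trans hz) huv.ne
    exact Prod.ext (Eq.symm hz) (h2.symm.trans g2)

theorem encard_fiber_fst {V : Type*} (m : ℕ) (u : V) :
    {x : V × Fin m | x.1 = u}.encard = m := by
  have : {x : V × Fin m | x.1 = u} = Set.range (Prod.mk u) := by
    ext ⟨v, i⟩
    simp [eq_comm]
  rw [this, ← Set.image_univ, (Prod.mk_right_injective u).encard_image, Set.encard_univ]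
  simp

theorem trivialCover_numColorings_le {V : Type*} [Fintype V] (G : SimpleGraph V) {m : ℕ}
    (hm : 0 < m) : (trivialCover G hm).numColorings ≤ numProperColorings G m := by
  classical
  have hfin : Finite (G.Coloring (Fin m)) := DFunLike.finite _
  rw [numProperColorings, ← Set.ncard_univ]
  refine le_trans (Set.ncard_le_ncard ?_ (Set.toFinite _)) (Set.ncard_image_le
    (f := fun c : G.Coloring (Fin m) => Finset.univ.image fun u => (u, c u)) (Set.toFinite _))
  intro I hI
  obtain ⟨f, hf, hind, rfl⟩ := (trivialCover G hm).exists_transversal hI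
  have hf' : ∀ u, (f u).1 = u := hf
  refine ⟨SimpleGraph.Coloring.mk (fun u => (f u).2) ?_, Set.mem_univ _, ?_⟩
  · intro u v huv heq
    refine hind u v (Or.inr ⟨?_, heq⟩)
    rwa [hf', hf']
  · have hfun : (fun u => (u, (f u).2)) = f := funext fun u => Prod.ext (hf' u).symm rfl
    change Finset.univ.image (fun u => (u, (f u).2)) = _
    rw [hfun]
    congr!

theorem dpColorFunction_le {V : Type*} [Fintype V] {G : SimpleGraph V} {m : ℕ} {W : Type}
    (C : Cover G W) (hC : C.IsFold m) : dpColorFunction G m ≤ C.numColorings :=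
  Nat.sInf_le ⟨W, C, hC, rfl⟩

theorem dpColorFunction_eq {V : Type} [Fintype V] {G : SimpleGraph V} {m : ℕ} (hm : 0 < m)
    (h : ∀ (W : Type) (C : Cover G W), C.IsFold m → numProperColorings G m ≤ C.numColorings) :
    dpColorFunction G m = numProperColorings G m := by
  have hfold : (trivialCover G hm).IsFold m := encard_fiber_fst m
  refine le_antisymm ((dpColorFunction_le _ hfold).trans (trivialCover_numColorings_le G hm)) ?_
  refine le_csInf ⟨_, _, _, hfold, rfl⟩ ?_
  rintro _ ⟨W, C, hC, rfl⟩
  exact h W C hC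

/-! ### The twisted cover -/

/-- The vertices of the cycle alternate between two representatives. -/
def alternate {p n : ℕ} : Fin p ⊕ Fin n → Fin p ⊕ Fin 2 :=
  Sum.map id fun j => if Even (j : ℕ) then 0 else 1

theorem twistedCover_isFold (p n : ℕ) : (twistedCover p n).IsFold (p + 2) :=
  encard_fiber_fst (p + 2)

theorem isFirstLast_inr_iff {p n : ℕ} {a b : Fin n} :
    IsFirstLast (Sum.inr a : Fin p ⊕ Fin n) (Sum.inr b) ↔ (a : ℕ) = 0 ∧ (b : ℕ) = n - 1 := by
  constructor
  · rintro ⟨a', b', ha, hb, h⟩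
    cases ha
    cases hb
    exact h
  · exact fun h => ⟨a, b, rfl, rfl, h⟩

/-- In the twisted cover with an even cycle, a coloring uses on the cycle exactly the two colors
that are not used on the complete graph, in alternation. -/
theorem exists_alternate_of_avoids_twist {p t : ℕ} (ht : 2 ≤ t) (hodd : Odd t)
    (c : Fin p ⊕ Fin (t + 1) → Fin (p + 2))
    (hc : ∀ u v, (completeJoinCycle p (t + 1)).Adj u v → ¬ twistMatched u v (c u) (c v)) :
    ∃ g : Fin p ⊕ Fin 2 ↪ Fin (p + 2), g (Sum.inr 1) ≠ g (Sum.inr 0) + 1 ∧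
      ∀ u, c u = g (alternate u) := by
  have hplain : ∀ u v, (completeJoinCycle p (t + 1)).Adj u v → ¬ IsFirstLast u v →
      ¬ IsFirstLast v u → c u ≠ c v := fun u v huv h h' heq =>
    hc u v huv (Or.inr (Or.inr ⟨h, h', heq⟩))
  have hll : ∀ i j : Fin p, i ≠ j → c (Sum.inl i) ≠ c (Sum.inl j) := fun i j hij =>
    hplain _ _ (completeJoinCycle_adj_inl_inl.2 hij) (by rintro ⟨_, _, h, -⟩; cases h)
      (by rintro ⟨_, _, h, -⟩; cases h)
  have hlr : ∀ (i : Fin p) (j : Fin (t + 1)), c (Sum.inl i) ≠ c (Sum.inr j) := fun i j =>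
    hplain _ _ (completeJoinCycle_adj_inl_inr i j) (by rintro ⟨_, _, h, -⟩; cases h)
      (by rintro ⟨_, _, -, h, -⟩; cases h)
  have hrr : ∀ j : Fin t, c (Sum.inr j.castSucc) ≠ c (Sum.inr j.succ) := fun j =>
    hplain _ _ ((completeJoinCycle_adj_inr_inr (by omega)).2
        (Or.inl (Fin.coeSucc_eq_succ).symm))
      (by
        rw [isFirstLast_inr_iff, Fin.val_castSucc, Fin.val_succ]
        omega)
      (by
        rw [isFirstLast_inr_iff, Fin.val_castSucc, Fin.val_succ]
        omega)
  have hlast : c (Sum.inr (Fin.last t)) ≠ c (Sum.inr 0) + 1 := fun heq =>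
    hc (Sum.inr 0) (Sum.inr (Fin.last t))
      ((completeJoinCycle_adj_inr_inr (by omega)).2 (Or.inr (Fin.last_add_one t).symm))
      (Or.inl ⟨isFirstLast_inr_iff.2 ⟨rfl, by simp⟩, heq⟩)
  obtain ⟨s, rfl⟩ : ∃ s, t = s + 1 := ⟨t - 1, by omega⟩
  have h01 : c (Sum.inr 0) ≠ c (Sum.inr 1) := hrr 0
  let g : Fin p ⊕ Fin 2 → Fin (p + 2) :=
    Sum.elim (fun i => c (Sum.inl i)) ![c (Sum.inr 0), c (Sum.inr 1)]
  have hg : Function.Injective g := by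
    have h2 : ∀ (i : Fin p) (k : Fin 2), g (Sum.inl i) ≠ g (Sum.inr k) := by
      intro i k
      fin_cases k
      · exact hlr i 0
      · exact hlr i 1
    rintro (i | k) (j | l) hij
    · by_contra hne
      exact hll i j (fun h => hne (congrArg _ h)) hij
    · exact absurd hij (h2 i l)
    · exact absurd hij.symm (h2 j k)
    · fin_cases k <;> fin_cases l
      · rfl
      · exact absurd hij h01
      · exact absurd hij.symm h01
      · rfl
  -- The colors of the complete graph and of the first two cycle vertices exhaust all `p + 2`, so
  -- each further cycle vertex must take the one of the latter two that its predecessor lacks.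
  have hsurj : Function.Surjective g :=
    ((Fintype.bijective_iff_injective_and_card g).2 ⟨hg, by simp⟩).2
  have halt : ∀ u, c u = g (alternate u) := by
    rintro (i | j)
    · rfl
    · induction j using Fin.induction with
      | zero => simp [alternate, g]
      | succ j ih =>
        obtain ⟨x, hx⟩ := hsurj (c (Sum.inr j.succ))
        have hne := hrr j
        rw [ih, ← hx] at hne
        rw [← hx]
        refine congrArg g ?_
        rcases x with i | k
        · exact absurd hx (hlr i _)
        · have hk : k ≠ if Even (j : ℕ) then 0 else 1 := by
            rintro rfl
            exact hne rfl
          simp only [alternate, Sum.map_inr, Fin.val_succ, Nat.even_add_one]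
          split_ifs at hk ⊢ <;> congr 1 <;> omega
  refine ⟨⟨g, hg⟩, ?_, halt⟩
  have h1 : alternate (Sum.inr (Fin.last (s + 1)) : Fin p ⊕ Fin (s + 1 + 1)) = Sum.inr 1 := by
    simp only [alternate, Sum.map_inr, Fin.val_last]
    rw [if_neg (Nat.not_even_iff_odd.2 hodd)]
  rw [halt, h1] at hlast
  exact hlast

theorem twistedCover_numColorings_lt {p t : ℕ} (ht : 2 ≤ t) (hodd : Odd t) :
    (twistedCover p (t + 1)).numColorings < (p + 2)! := by
  classical
  let E : Finset (Fin p ⊕ Fin 2 ↪ Fin (p + 2)) :=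
    Finset.univ.filter fun g => g (Sum.inr 1) ≠ g (Sum.inr 0) + 1
  have hlt : E.card < (p + 2)! := by
    have hcard : Fintype.card (Fin p ⊕ Fin 2 ↪ Fin (p + 2)) = (p + 2)! := by
      rw [Fintype.card_embedding_eq, Fintype.card_sum, Fintype.card_fin, Fintype.card_fin,
        Fintype.card_fin, Nat.descFactorial_self]
    rw [← hcard]
    -- This embedding gives the two cycle representatives the consecutive colors `p` and `p + 1`,
    -- which the twisted edge forbids.
    refine Finset.card_lt_univ_of_notMem (x := finSumFinEquiv.toEmbedding) ?_
    intro h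
    refine (Finset.mem_filter.1 h).2 (Fin.ext ?_)
    simp [Fin.val_add]
  refine lt_of_le_of_lt ?_ hlt
  rw [← Set.ncard_coe_finset]
  refine le_trans (Set.ncard_le_ncard ?_ (Set.toFinite _)) (Set.ncard_image_le
    (f := fun g : Fin p ⊕ Fin 2 ↪ Fin (p + 2) =>
      (Finset.univ : Finset (Fin p ⊕ Fin (t + 1))).image fun u => (u, g (alternate u)))
    (Set.toFinite _))
  intro I hI
  obtain ⟨f, hf, hind, rfl⟩ := (twistedCover p (t + 1)).exists_transversal hI
  have hf' : ∀ u, (f u).1 = u := hf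
  obtain ⟨g, hg, hgf⟩ := exists_alternate_of_avoids_twist ht hodd (fun u => (f u).2)
    fun u v huv htw => hind u v (Or.inr (by rw [hf', hf']; exact ⟨huv, htw⟩))
  refine ⟨g, Finset.mem_coe.2 (Finset.mem_filter.2 ⟨Finset.mem_univ _, hg⟩), ?_⟩
  have hfun : (fun u => (u, g (alternate u))) = f :=
    funext fun u => Prod.ext (hf' u).symm (hgf u).symm
  change Finset.univ.image (fun u => (u, g (alternate u))) = _
  rw [hfun]
  congr!

/-! ### The threshold -/

theorem dpColorFunction_completeJoinCycle {p t m : ℕ} (hp : 1 ≤ p) (ht : 2 ≤ t)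
    (hm : p + 3 ≤ m) :
    dpColorFunction (completeJoinCycle p (t + 1)) m =
      numProperColorings (completeJoinCycle p (t + 1)) m := by
  obtain ⟨r, rfl⟩ : ∃ r, p = r + 1 := ⟨p - 1, by omega⟩
  obtain ⟨q, rfl⟩ : ∃ q, m = q + 1 + (r + 1) := ⟨m - r - 2, by omega⟩
  refine dpColorFunction_eq (by omega) fun W C hC => ?_
  have hqr : q + 1 + (r + 1) = q + 2 + r := by ring
  rw [hqr] at hC
  have h := le_numColorings_completeJoinCycle (by omega) ht C hC
  rw [← hqr, ← numProperColorings_completeJoinCycle (by omega)] at h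
  exact_mod_cast h

theorem numProperColorings_pos_iff {V : Type*} [Finite V] {G : SimpleGraph V} {m : ℕ} :
    0 < numProperColorings G m ↔ G.chromaticNumber ≤ m := by
  have : Finite (G.Coloring (Fin m)) := DFunLike.finite _
  rw [numProperColorings, SimpleGraph.chromaticNumber_le_iff_colorable, Nat.card_pos_iff]
  exact ⟨fun h => h.1, fun h => ⟨h, this⟩⟩

theorem chromaticNumber_completeJoinCycle_le {p t : ℕ} (ht : 1 ≤ t) :
    (completeJoinCycle p (t + 1)).chromaticNumber ≤ (p + 3 : ℕ) := by
  rw [← numProperColorings_pos_iff, ← Nat.cast_pos (α := ℤ), show p + 3 = 2 + 1 + p by ring,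
    numProperColorings_completeJoinCycle ht]
  have h1 := walkCount_pos (le_refl 2) ht
  have h2 : 0 < (2 + 1 + p).descFactorial p := Nat.descFactorial_pos.2 (by omega)
  positivity

theorem numProperColorings_completeJoinCycle_add_two {p t : ℕ} (ht : 1 ≤ t) :
    (numProperColorings (completeJoinCycle p (t + 1)) (p + 2) : ℤ) =
      (p + 2).descFactorial p * (1 - (-1) ^ t) := by
  rw [show p + 2 = 1 + 1 + p by ring, numProperColorings_completeJoinCycle ht]
  have h := succ_mul_walkCount 1 t
  rw [Nat.cast_one, one_pow] at h
  rw [← h]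
  push_cast
  ring

end DPColoring

theorem mainTheorem3 (p n : ℕ) (hp : 1 ≤ p) (hn : 3 ≤ n) :
    DPColoring.dpThreshold (DPColoring.completeJoinCycle p n) = ((p + 3 : ℕ) : ℕ∞) ∧
    (Even n →
      (DPColoring.twistedCover p n).IsFold (p + 2) ∧
      (DPColoring.twistedCover p n).numColorings < (p + 2)!) := by
  obtain ⟨t, rfl⟩ : ∃ t, n = t + 1 := ⟨n - 1, by omega⟩
  have ht : 2 ≤ t := by omega
  refine ⟨le_antisymm (sInf_le ⟨p + 3, rfl, ?_, ?_⟩) (le_sInf ?_), fun heven => ?_⟩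
  · exact DPColoring.chromaticNumber_completeJoinCycle_le (by omega)
  · exact fun m hm => DPColoring.dpColorFunction_completeJoinCycle hp ht hm
  · rintro _ ⟨N, rfl, hchi, hN⟩
    rw [Nat.cast_le]
    by_contra hlt
    have hcount := DPColoring.numProperColorings_completeJoinCycle_add_two (p := p)
      (by omega : 1 ≤ t)
    -- For even `t` the cycle is odd, so `p + 2` colors do not suffice and `χ ≤ N` fails; for odd
    -- `t` the twisted cover refutes the equality at `m = p + 2`.
    rcases Nat.even_or_odd t with heven | hodd
    · have hpos := DPColoring.numProperColorings_pos_iff.2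
        (hchi.trans (Nat.cast_le.2 (by omega : N ≤ p + 2)))
      rw [heven.neg_one_pow, sub_self, mul_zero, Nat.cast_eq_zero] at hcount
      omega
    · have hdp := DPColoring.dpColorFunction_le _ (DPColoring.twistedCover_isFold p (t + 1))
      have hlt' := DPColoring.twistedCover_numColorings_lt (p := p) ht hodd
      rw [hN (p + 2) (by omega)] at hdp
      have hfac : (p + 2).descFactorial p * 2 = (p + 2)! := by
        rw [← Nat.factorial_mul_descFactorial (by omega : p ≤ p + 2), Nat.add_sub_cancel_left,
          Nat.factorial_two, mul_comm]
      rw [hodd.neg_one_pow] at hcount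
      have : DPColoring.numProperColorings (DPColoring.completeJoinCycle p (t + 1)) (p + 2) =
          (p + 2)! := by
        rw [← hfac]
        zify
        linarith
      omega
  · exact ⟨DPColoring.twistedCover_isFold p (t + 1),
      DPColoring.twistedCover_numColorings_lt ht (by
        rwa [Nat.even_add_one, Nat.not_even_iff_odd] at heven)⟩
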